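/- Let $\mathcal{G}_{\mathrm{all}}$ be the set of all finite, undirected, simple graphs, $|G|$ the number of vertices of $G$, and let $\le$ be a quasi-ordering (a reflexive and transitive relation) on $\mathcal{G}_{\mathrm{all}}$. *Orders.* A well-quasi-ordering (wqo) is a quasi-ordering that is well-founded and has no infinite antichain. It is an $\omega^2$-wqo if it is a wqo that contains no isomorphic copy of the Rado structure $(\{(i,j)\in\mathbb{N}^2 : i<j\},\le_r)$, where $(i,j)\le_r(i',j')$ iff ($i=i'$ and $j\le j'$) or $j<i'$. *Parameters.* A graph parameter is a function $p:\mathcal{G}_{\mathrm{all}}\to\mathbb{N}\cup\{\infty\}$, and $\mathrm{dom}(p)=\{G : p(G)<\infty\}$. It is $\le$-monotone if $H\le G$ implies $p(H)\le p(G)$. Write $p\preceq p'$ if $\mathrm{dom}(p')\subseteq\mathrm{dom}(p)$ and there is $f:\mathbb{N}\to\mathbb{N}$ with $p(G)\le f(p'(G))$ for all $G\in\mathrm{dom}(p')$, and $p\sim p'$ if $p\preceq p'$ and $p'\preceq p$. *Universal obstructions.* A graph sequence $\mathcal{H}=(\mathcal{H}_k)_{k\in\mathbb{N}}$ is prime if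 the largest $\le$-antichain among its members has size $1$ and, as is assumed by convention, it is monotone: $\mathcal{H}_i\le\mathcal{H}_j$ for $i\le j$. For prime sequences, $\mathcal{H}\lesssim\mathcal{F}$ means that there is $f:\mathbb{N}\to\mathbb{N}$ with $\mathcal{H}_k\le\mathcal{F}_{f(k)}$ for all $k$. A prime collection is a countable set $\mathfrak{H}$ of prime sequences that is a $\lesssim$-antichain. Put $$p_{\mathcal{H}}(G)=\min\{k\in\mathbb{N} : \text{no } \le\text{-minimal element } H \text{ of } \{\mathcal{H}_i : i\ge k\} \text{ satisfies } H\le G\},\qquad p_{\mathfrak{H}}(G)=\max_{\mathcal{H}\in\mathfrak{H}}p_{\mathcal{H}}(G),$$ with $\min\emptyset=\infty$ and with maximum $0$ over the empty collection. A prime collection $\mathfrak{H}$ is a universal obstruction of $p$ if $p_{\mathfrak{H}}\sim p$. It is effective if $\mathfrak{H}$ is finite and there is an algorithm that, given $k\in\mathbb{N}$, outputs the set $\{\mathcal{H}_k : \mathcal{H}\in\mathfrak{H}\}$. *Decidability.* The relation $\le$ is FPT-decidable if there are an algorithm, a function $f:\mathbb{N}\to\mathbb{N}$ (not necessarily computable)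 and a constant $c$ such that, given (an encoding $x$ of) two graphs $H$ and $G$, the algorithm decides whether $H\le G$ in at most $f(|H|)\cdot|x|^{c}$ steps. **Corollary 45.** Assume that $\le$ is a wqo on $\mathcal{G}_{\mathrm{all}}$ and that $\le$ is FPT-decidable. Then $\le$ is an $\omega^2$-wqo on $\mathcal{G}_{\mathrm{all}}$ if and only if every $\le$-monotone graph parameter has an effective universal obstruction. -/

import Mathlib

/-! ## Quasi-orders -/

/-- `MIN(A)`: the minimal elements of `A` with respect to the quasi-order `le`. -/
def minSet {α : Type*} (le : α → α → Prop) (A : Set α) : Set α :=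
  {x | x ∈ A ∧ ∀ y ∈ A, le y x → le x y}

/-- The extension of a relation to sets: every element of `B` is above some element of `A`. -/
def StarLE {α : Type*} (le : α → α → Prop) (A B : Set α) : Prop :=
  ∀ y ∈ B, ∃ x ∈ A, le x y

/-- The underlying set of the Rado structure: pairs `(i, j)` of naturals with `i < j`. -/
abbrev RadoPair : Type := {x : ℕ × ℕ // x.1 < x.2}

/-- The order of the Rado structure. -/
def radoLE (x y : RadoPair) : Prop :=
  (x.1.1 = y.1.1 ∧ x.1.2 ≤ y.1.2) ∨ x.1.2 < y.1.1

/-- An `ω²`-wqo: a well-quasi-order that contains no isomorphic copy of the Rado structure. -/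
def IsOmegaSqWqo {α : Type*} (le : α → α → Prop) : Prop :=
  WellQuasiOrdered le ∧ IsEmpty (radoLE ↪r le)

/-! ## Graphs and graph parameters -/

/-- Finite simple undirected graphs (on the vertex sets `Fin n`, up to isomorphism all of them). -/
abbrev FinGraph : Type := Σ n : ℕ, SimpleGraph (Fin n)

/-- The size of a graph: its number of vertices. -/
def FinGraph.size (G : FinGraph) : ℕ := G.1

/-- A graph parameter takes values in the non-negative integers and infinity. -/
abbrev GraphParam : Type := FinGraph → ℕ∞

/-- The graphs on which a parameter is finite. -/
def GraphParam.dom (p : GraphParam) : Set FinGraph := {G | p G ≠ ⊤}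

/-- Monotonicity of a parameter with respect to a relation on graphs. -/
def GraphParam.IsMonotone (le : FinGraph → FinGraph → Prop) (p : GraphParam) : Prop :=
  ∀ H G : FinGraph, le H G → p H ≤ p G

/-- `p ≼ q`: `dom q ⊆ dom p`, and on `dom q` the parameter `p` is bounded by a function of `q`. -/
def GraphParam.AsympLE (p q : GraphParam) : Prop :=
  q.dom ⊆ p.dom ∧ ∃ f : ℕ → ℕ, ∀ G : FinGraph, ∀ n : ℕ, q G = n → p G ≤ f n

/-- Asymptotic equivalence of parameters. -/
def GraphParam.AsympEquiv (p q : GraphParam) : Prop := p.AsympLE q ∧ q.AsympLE p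

/-! ## Graph sequences and prime collections -/

/-- A graph sequence, or parametric graph, indexed by the non-negative integers. -/
abbrev GraphSeq : Type := ℕ → FinGraph

/-- The set of members of the sequence with index at least `k`. -/
def GraphSeq.tail (H : GraphSeq) (k : ℕ) : Set FinGraph := {G | ∃ i, k ≤ i ∧ G = H i}

/-- The width of a sequence: the supremum of the sizes of the antichains among its members. -/
noncomputable def GraphSeq.width (le : FinGraph → FinGraph → Prop) (H : GraphSeq) : ℕ∞ :=
  ⨆ (A : Set FinGraph) (_ : A ⊆ Set.range H) (_ : IsAntichain le A), A.encard

/-- Monotone sequences. -/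
def GraphSeq.IsMonotone (le : FinGraph → FinGraph → Prop) (H : GraphSeq) : Prop :=
  ∀ i j : ℕ, i ≤ j → le (H i) (H j)

/-- Prime sequences: sequences of width one, with the convention that prime sequences are
monotone. -/
def GraphSeq.IsPrime (le : FinGraph → FinGraph → Prop) (H : GraphSeq) : Prop :=
  H.width le = 1 ∧ H.IsMonotone le

/-- `H ≲ F`: every member of `H` is below some member of `F`, as witnessed by a function on the
indices. -/
def GraphSeq.LE (le : FinGraph → FinGraph → Prop) (H F : GraphSeq) : Prop :=
  ∃ f : ℕ → ℕ, ∀ k : ℕ, le (H k) (F (f k))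

/-- The parameter of a sequence: the least `k` such that `MIN` of the members of index at least `k`
is not below `{G}`, and infinity if there is no such `k`. -/
noncomputable def GraphSeq.param (le : FinGraph → FinGraph → Prop) (H : GraphSeq) : GraphParam :=
  fun G => ⨅ (k : ℕ) (_ : ¬ StarLE le (minSet le (H.tail k)) {G}), (k : ℕ∞)

/-- A prime collection: a countable set of prime sequences that is an antichain for `≲`. -/
def IsPrimeCollection (le : FinGraph → FinGraph → Prop) (S : Set GraphSeq) : Prop :=
  S.Countable ∧ (∀ H ∈ S, H.IsPrime le) ∧ IsAntichain (GraphSeq.LE le) S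

/-- The parameter of a collection of sequences: the maximum of the parameters of its members
(zero for the empty collection). -/
noncomputable def collectionParam (le : FinGraph → FinGraph → Prop) (S : Set GraphSeq) :
    GraphParam :=
  fun G => ⨆ H ∈ S, H.param le G

/-- `S` is a universal obstruction for the parameter `p`. -/
def IsUniversalObstruction (le : FinGraph → FinGraph → Prop) (S : Set GraphSeq)
    (p : GraphParam) : Prop :=
  IsPrimeCollection le S ∧ (collectionParam le S).AsympEquiv p

/-! ## Algorithms on graphs -/

/-- The four letter alphabet for graphs: `inl b` is a bit, `inr false` ends a row of the
adjacency matrix, `inr true` ends the graph. -/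
abbrev GraphLetter : Type := Bool ⊕ Bool

open Classical in
/-- A graph as a word: the rows of its adjacency matrix, each followed by an end-of-row letter,
and then an end-of-graph letter. -/
noncomputable def FinGraph.encode (G : FinGraph) : List GraphLetter :=
  (List.finRange G.1).flatMap (fun i =>
    (List.finRange G.1).map (fun j => Sum.inl (decide (G.2.Adj i j))) ++ [Sum.inr false])
  ++ [Sum.inr true]

/-- A finite list of graphs as a word. -/
noncomputable def encodeGraphs (l : List FinGraph) : List GraphLetter :=
  l.flatMap FinGraph.encode

open Classical in
/-- The parameterized problem with instances `x : α`, written as words `enc x` over the alphabet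
`Γ`, with yes-instances `Q` and parameter `κ`, is fixed parameter tractable: some multi-stack
Turing machine answers `Q x` on input `enc x` within `f (κ x) * |enc x| ^ c` steps, for some
function `f` (not required to be computable) and some constant `c`. -/
def IsFPT {α Γ : Type} (enc : α → List Γ) (Q : α → Prop) (κ : α → ℕ) : Prop :=
  ∃ (M : Turing.TM2ComputableAux Γ Bool) (f : ℕ → ℕ) (c : ℕ), ∀ x : α,
    Nonempty (Turing.TM2OutputsInTime M.tm
      ((enc x).map M.inputAlphabet.invFun)
      (some ([decide (Q x)].map M.outputAlphabet.invFun))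
      (f (κ x) * (enc x).length ^ c))

/-- A relation on graphs is FPT-decidable: deciding whether `H` is below `G`, given the pair
`(H, G)`, is fixed parameter tractable when parameterized by the size of `H`. -/
def IsFPTDecidable (le : FinGraph → FinGraph → Prop) : Prop :=
  IsFPT (fun x : FinGraph × FinGraph => encodeGraphs [x.1, x.2])
    (fun x => le x.1 x.2) (fun x => x.1.size)

/-- A collection of sequences is effective: it is finite, and there is an algorithm that, given
`k`, outputs (as a list, in some order) the set of the `k`-th members of its sequences. -/
def IsEffective (S : Set GraphSeq) : Prop :=
  S.Finite ∧ ∃ out : ℕ → List FinGraph,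
    (∀ k : ℕ, {G | G ∈ out k} = {G | ∃ H ∈ S, G = H k}) ∧
    Computable (fun k => encodeGraphs (out k))

/-!
Call a class of graphs lower if it is closed downwards, and call a monotone parameter `p` unbounded
on a class if it takes arbitrarily large values there. A finite set of monotone sequences is
equivalent to `p` if and only if the lower classes on which `p` is unbounded are exactly those that
contain one of the sequences (`collectionParam_asympEquiv_iff`). Universal obstructions are thus
generating sequences of the minimal lower classes on which `p` is unbounded.

In a well-quasi-order every lower class on which `p` is unbounded contains a minimal one, and the
minimal ones are directed, as `p` is bounded on every union of two classes on which it is bounded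
(`IsMinimalUnbounded.directed`). They form an antichain for inclusion. By Rado's theorem
(`nonempty_radoLE_relEmbedding`, a consequence of Ramsey's theorem for quadruples) an infinite such
antichain would produce a copy of the Rado structure, so in an `ω²`-wqo there are finitely many.
A lower class is determined by finitely many excluded graphs, so its membership problem is
computable once `le` is, and a directed one has a computable cofinal sequence, found by search
(`exists_computable_cofinal`). That `le` is computable in the sense of `Computable` follows by
simulating the stack machine given by `IsFPTDecidable` (`computable_of_tm2Outputs`).

Conversely, given a copy of the Rado structure, let `p` be the largest second index of a pair below
the graph. It is unbounded on the lower class of each row and bounded on the intersection of the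
classes of two rows, so each row requires a sequence of its own
(`radoParam_no_finite_obstruction`).
-/

/-! ### Ramsey's theorem for sorted lists -/

/-- **Infinite Ramsey theorem**: every finite colouring of the `n`-element sets of naturals, given
as strictly sorted lists, is constant on the `n`-element subsets of some infinite set. -/
theorem exists_infinite_monochromatic {κ : Type*} [Finite κ] (n : ℕ) :
    ∀ (c : List ℕ → κ) (A : Set ℕ), A.Infinite → ∃ B ⊆ A, B.Infinite ∧ ∃ k : κ,
      ∀ l : List ℕ, l.length = n → l.Pairwise (· < ·) → (∀ x ∈ l, x ∈ B) → c l = k := by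
  induction n with
  | zero =>
    intro c A hA
    refine ⟨A, subset_rfl, hA, c [], fun l hl _ _ => ?_⟩
    rw [List.length_eq_zero_iff.1 hl]
  | succ n ih =>
    intro c A hA
    have key : ∀ A : {A : Set ℕ // A.Infinite}, ∃ B : {B : Set ℕ // B.Infinite},
        (∀ x ∈ B.1, x ∈ A.1 ∧ sInf A.1 < x) ∧ ∃ k : κ, ∀ l : List ℕ, l.length = n →
          l.Pairwise (· < ·) → (∀ x ∈ l, x ∈ B.1) → c (sInf A.1 :: l) = k := by
      intro A
      obtain ⟨B, hBA, hB, k, hk⟩ := ih (fun l => c (sInf A.1 :: l)) {x ∈ A.1 | sInf A.1 < x}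
        (by
          have : {x ∈ A.1 | sInf A.1 < x} = A.1 \ Set.Iic (sInf A.1) := by
            ext x; simp
          rw [this]
          exact A.2.sdiff (Set.finite_Iic _))
      exact ⟨⟨B, hB⟩, fun x hx => hBA hx, k, hk⟩
    choose next hnext col hcol using key
    let F : ℕ → {A : Set ℕ // A.Infinite} := fun t => next^[t] ⟨A, hA⟩
    have hF : ∀ t, F (t + 1) = next (F t) := fun t => Function.iterate_succ_apply' next t _
    let a : ℕ → ℕ := fun t => sInf (F t).1
    have hanti : Antitone fun t => (F t).1 := antitone_nat_of_succ_le fun t => by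
      rw [hF]
      exact fun x hx => (hnext (F t) x hx).1
    have ha : ∀ t, a t ∈ (F t).1 := fun t => Nat.sInf_mem (F t).2.nonempty
    have ha' : ∀ {s t}, s < t → a t ∈ (F (s + 1)).1 := fun {s t} h =>
      hanti (Nat.succ_le_of_lt h) (ha t)
    have hmono : StrictMono a := strictMono_nat_of_lt_succ fun t => by
      have := ha (t + 1)
      rw [hF] at this
      exact (hnext (F t) _ this).2
    obtain ⟨k, hk⟩ := Finite.exists_infinite_fiber fun t => col (F t)
    rw [Set.infinite_coe_iff] at hk
    refine ⟨a '' ((fun t => col (F t)) ⁻¹' {k}), ?_, hk.image hmono.injective.injOn, k, ?_⟩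
    · rintro _ ⟨t, -, rfl⟩
      exact hanti (Nat.zero_le t) (ha t)
    · intro l hl hs hm
      match l, hl, hs, hm with
      | x :: l, hl, hs, hm =>
        obtain ⟨t, ht, rfl⟩ := hm x (by simp)
        rw [← show col (F t) = k from ht]
        rw [List.pairwise_cons] at hs
        refine hcol (F t) l (by simpa using hl) hs.2 fun y hy => ?_
        obtain ⟨s, -, rfl⟩ := hm y (by simp [hy])
        rw [← hF]
        exact ha' (hmono.lt_iff_lt.1 (hs.1 _ hy))

/-! ### The Rado structure inside a well-quasi-order -/

section Rado

variable {α : Type*} {le : α → α → Prop}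

theorem radoLE_antisymm {x y : RadoPair} (h : radoLE x y) (h' : radoLE y x) : x = y := by
  obtain ⟨⟨i, j⟩, hx⟩ := x
  obtain ⟨⟨k, l⟩, hy⟩ := y
  simp only [radoLE] at h h' hx hy
  ext <;> simp only <;> omega

theorem WellQuasiOrdered.refl' (hwqo : WellQuasiOrdered le) (x : α) : le x x := by
  obtain ⟨_, _, -, h⟩ := hwqo fun _ => x
  exact h

/-- **Rado's theorem**: a sequence of lower sets of a well-quasi-order, none of which is contained
in a later one, yields a copy of the Rado structure. It consists of elements `x i j` of
`D i \ D j`, after passing to a subsequence along which the comparisons between `x i j` and `x k l`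
depend only on the relative order of the indices. -/
theorem nonempty_radoLE_relEmbedding (htrans : ∀ x y z, le x y → le y z → le x z)
    (hwqo : WellQuasiOrdered le) (D : ℕ → Set α) (hD : ∀ i x y, le x y → y ∈ D i → x ∈ D i)
    (hne : ∀ i j, i < j → ¬ D i ⊆ D j) : Nonempty (radoLE ↪r le) := by
  have hne' : ∀ i j, ∃ x, i < j → x ∈ D i ∧ x ∉ D j := by
    intro i j
    by_cases h : i < j
    · obtain ⟨x, hx⟩ := Set.not_subset.1 (hne i j h)
      exact ⟨x, fun _ => hx⟩
    · obtain ⟨x, -⟩ := Set.not_subset.1 (hne 0 1 one_pos)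
      exact ⟨x, fun h' => absurd h' h⟩
  choose x₀ hx₀ using hne'
  obtain ⟨B, -, hB, k, hk⟩ := exists_infinite_monochromatic (κ := Prop × Prop × Prop) 4
    (fun l => (le (x₀ l[0]! l[1]!) (x₀ l[0]! l[2]!), le (x₀ l[0]! l[1]!) (x₀ l[2]! l[3]!),
      le (x₀ l[1]! l[2]!) (x₀ l[0]! l[3]!))) Set.univ Set.infinite_univ
  -- Reindex along the homogeneous set.
  let φ : ℕ → ℕ := Nat.nth (· ∈ B)
  have hφ : StrictMono φ := Nat.nth_strictMono hB
  have hφB : ∀ i, φ i ∈ B := fun i => Nat.nth_mem_of_infinite hB i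
  let x : ℕ → ℕ → α := fun i j => x₀ (φ i) (φ j)
  have hx : ∀ {i j}, i < j → x i j ∈ D (φ i) ∧ x i j ∉ D (φ j) := fun h => hx₀ _ _ (hφ h)
  have hx1 : ∀ {i j}, i < j → x i j ∈ D (φ i) := fun h => (hx h).1
  have hx2 : ∀ {i j}, i < j → x i j ∉ D (φ j) := fun h => (hx h).2
  have hhom : ∀ {i j l m}, i < j → j < l → l < m →
      (le (x i j) (x i l), le (x i j) (x l m), le (x j l) (x i m)) = k := by
    intro i j l m h1 h2 h3
    refine hk [φ i, φ j, φ l, φ m] rfl ?_ ?_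
    · have h1 := hφ h1
      have h2 := hφ h2
      have h3 := hφ h3
      simp
      omega
    · simp [hφB]
  -- Rows increase.
  have row : ∀ {i j l}, i < j → j < l → le (x i j) (x i l) := by
    have : k.1 := by
      obtain ⟨m, n, hmn, h⟩ := hwqo fun m => x 0 (m + 1)
      rw [← hhom (show 0 < m + 1 by omega) (show m + 1 < n + 1 by omega) (Nat.lt_succ_self _)]
      exact h
    intro i j l h1 h2
    rwa [← hhom h1 h2 (Nat.lt_succ_self _)] at this
  -- Disjoint index pairs are comparable.
  have disj : ∀ {i j l m}, i < j → j < l → l < m → le (x i j) (x l m) := by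
    have : k.2.1 := by
      obtain ⟨m, n, hmn, h⟩ := hwqo fun m => x (2 * m) (2 * m + 1)
      rw [← hhom (show 2 * m < 2 * m + 1 by omega) (show 2 * m + 1 < 2 * n by omega)
        (Nat.lt_succ_self _)]
      exact h
    intro i j l m h1 h2 h3
    rwa [← hhom h1 h2 h3] at this
  -- Nested index pairs are incomparable: otherwise `x 0 1 ≤ x 2 3 ≤ x 1 4`.
  have nest : ∀ {i j l m}, i < j → j < l → l < m → ¬ le (x j l) (x i m) := by
    have : ¬ k.2.2 := by
      intro h
      rw [← hhom (show 1 < 2 by omega) (show 2 < 3 by omega) (show 3 < 4 by omega)] at h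
      exact hx2 (show 0 < 1 by omega) (hD _ _ _ (htrans _ _ _
        (disj (show 0 < 1 by omega) (show 1 < 2 by omega) (show 2 < 3 by omega)) h)
        (hx1 (show 1 < 4 by omega)))
    intro i j l m h1 h2 h3
    rwa [← hhom h1 h2 h3] at this
  have main : ∀ {i j l m}, i < j → l < m → (le (x i j) (x l m) ↔ (i = l ∧ j ≤ m) ∨ j < l) := by
    intro i j l m hij hlm
    constructor
    · intro h
      by_contra hcon
      -- An element of `D l` is not above `x i l`.
      have h1 : ¬ (i < l ∧ l ≤ j) := by
        rintro ⟨hil, hlj⟩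
        refine hx2 hil (hD _ _ _ (htrans _ (x i j) _ ?_ h) (hx1 hlm))
        rcases hlj.eq_or_lt with rfl | hlj
        · exact hwqo.refl' _
        · exact row hil hlj
      -- If `m < j` then `x i j ≤ x l m ≤ x j (j + 1) ∈ D j`.
      have h2 : ¬ m < j := fun hmj => hx2 hij (hD _ _ _
        (htrans _ _ _ h (disj hlm hmj (Nat.lt_succ_self j))) (hx1 (Nat.lt_succ_self j)))
      have h3 : ¬ l < i := by
        intro hli
        exact nest hli hij (show j < m + 1 by omega)
          (htrans _ _ _ h (row hlm (Nat.lt_succ_self m)))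
      omega
    · rintro (⟨rfl, hjm⟩ | hjl)
      · rcases hjm.eq_or_lt with rfl | hjm
        · exact hwqo.refl' _
        · exact row hij hjm
      · exact disj hij hjl hlm
  refine ⟨⟨⟨fun p => x p.1.1 p.1.2, ?_⟩, ?_⟩⟩
  · intro p q hpq
    have hpq : x p.1.1 p.1.2 = x q.1.1 q.1.2 := hpq
    apply radoLE_antisymm
    · exact (main p.2 q.2).1 (hpq ▸ hwqo.refl' _)
    · exact (main q.2 p.2).1 (hpq ▸ hwqo.refl' _)
  · intro p q
    exact main p.2 q.2

end Rado

/-! ### Obstructions and unbounded classes -/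

/-- The parameter `p` takes arbitrarily large values (possibly infinity) on the class `C`. -/
def GraphParam.IsUnboundedOn (p : GraphParam) (C : Set FinGraph) : Prop :=
  ∀ n : ℕ, ∃ G ∈ C, (n : ℕ∞) < p G

/-- Classes of graphs closed downwards under `le`. -/
def IsLowerClass (le : FinGraph → FinGraph → Prop) (C : Set FinGraph) : Prop :=
  ∀ H G, le H G → G ∈ C → H ∈ C

section Obstructions

variable {le : FinGraph → FinGraph → Prop} {p : GraphParam} {S : Set GraphSeq}

theorem GraphParam.IsUnboundedOn.mono {C D : Set FinGraph} (h : p.IsUnboundedOn C) (hCD : C ⊆ D) :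
    p.IsUnboundedOn D := fun n =>
  let ⟨G, hG, hn⟩ := h n
  ⟨G, hCD hG, hn⟩

theorem GraphParam.not_isUnboundedOn {C : Set FinGraph} :
    ¬ p.IsUnboundedOn C ↔ ∃ n : ℕ, ∀ G ∈ C, p G ≤ n := by
  simp only [IsUnboundedOn, not_forall, not_exists, not_and, not_lt]

/-- For a monotone sequence, `MIN` of a tail is represented by the first member of the tail. -/
theorem GraphSeq.param_le_iff (htrans : ∀ F G H, le F G → le G H → le F H) {H : GraphSeq}
    (hH : H.IsMonotone le) (G : FinGraph) (k : ℕ) : H.param le G ≤ k ↔ ¬ le (H k) G := by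
  have key : ∀ j, StarLE le (minSet le (H.tail j)) {G} ↔ le (H j) G := by
    intro j
    constructor
    · intro h
      obtain ⟨x, ⟨⟨i, hji, rfl⟩, -⟩, hx⟩ := h G rfl
      exact htrans _ _ _ (hH j i hji) hx
    · rintro h _ rfl
      exact ⟨H j, ⟨⟨j, le_rfl, rfl⟩, by rintro _ ⟨i, hji, rfl⟩ -; exact hH j i hji⟩, h⟩
  simp only [param, key]
  constructor
  · intro h hle
    have : ((k + 1 : ℕ) : ℕ∞) ≤ ⨅ (j : ℕ) (_ : ¬ le (H j) G), (j : ℕ∞) := by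
      refine le_iInf₂ fun j hj => Nat.cast_le.2 ?_
      by_contra hcon
      exact hj (htrans _ _ _ (hH j k (by omega)) hle)
    have := Nat.cast_le.1 (this.trans h)
    omega
  · intro h
    exact iInf₂_le k h

theorem collectionParam_le_iff (htrans : ∀ F G H, le F G → le G H → le F H)
    (hS : ∀ H ∈ S, GraphSeq.IsMonotone le H)
    (G : FinGraph) (k : ℕ) : collectionParam le S G ≤ k ↔ ∀ H ∈ S, ¬ le (H k) G := by
  simp only [collectionParam, iSup_le_iff]
  exact forall₂_congr fun H hH => GraphSeq.param_le_iff htrans (hS H hH) G k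

theorem exists_uniform_bound {β : Type*} {T : Set β} (hT : T.Finite) {P : β → ℕ → Prop}
    (hP : ∀ H m n, m ≤ n → P H m → P H n) (h : ∀ H ∈ T, ∃ n, P H n) : ∃ n, ∀ H ∈ T, P H n := by
  choose! f hf using h
  obtain ⟨n, hn⟩ := (hT.image f).bddAbove
  exact ⟨n, fun H hH => hP H _ _ (hn ⟨H, hH, rfl⟩) (hf H hH)⟩

/-- A finite set of monotone sequences determines the parameter `p` up to equivalence if and only if
the lower classes on which `p` is unbounded are exactly those containing one of the sequences. -/
theorem collectionParam_asympEquiv_iff (hrefl : ∀ G, le G G)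
    (htrans : ∀ F G H, le F G → le G H → le F H) (hp : p.IsMonotone le) (hfin : S.Finite)
    (hS : ∀ H ∈ S, GraphSeq.IsMonotone le H) :
    (collectionParam le S).AsympEquiv p ↔
      (∀ H ∈ S, p.IsUnboundedOn (Set.range H)) ∧
      ∀ C, IsLowerClass le C → p.IsUnboundedOn C → ∃ H ∈ S, Set.range H ⊆ C := by
  have hle := collectionParam_le_iff htrans hS
  have hanti : ∀ H ∈ S, ∀ G m n, m ≤ n → ¬ le (H m) G → ¬ le (H n) G :=
    fun H hH G m n hmn h h' => h (htrans _ _ _ (hS H hH m n hmn) h')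
  -- A function bounding one parameter by another can be taken to be monotone.
  have hmono : ∀ (f : ℕ → ℕ) (N n : ℕ), n ≤ N → f n ≤ ∑ i ∈ Finset.range (N + 1), f i :=
    fun f N n hn => Finset.single_le_sum (f := f) (fun _ _ => Nat.zero_le _)
      (Finset.mem_range.2 (by omega))
  constructor
  · rintro ⟨⟨-, f, hf⟩, -, g, hg⟩
    constructor
    · intro H hH
      by_contra hcon
      obtain ⟨n, hn⟩ := GraphParam.not_isUnboundedOn.1 hcon
      let M := ∑ i ∈ Finset.range (n + 1), f i
      have hM := hn (H M) ⟨M, rfl⟩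
      obtain ⟨m, hm⟩ := ENat.ne_top_iff_exists.1 (ne_top_of_le_ne_top (ENat.natCast_ne_top n) hM)
      have h1 := hf (H M) m hm.symm
      rw [← hm, Nat.cast_le] at hM
      have h2 := (hle (H M) M).1 (h1.trans (Nat.cast_le.2 (hmono f n m hM))) H hH
      exact h2 (hrefl _)
    · intro C hC hunb
      by_contra! hcon
      obtain ⟨K, hK⟩ := exists_uniform_bound (P := fun H n => H ∈ S → H n ∉ C) hfin
        (fun H m n hmn h hH hn => h hH (hC _ _ (hS H hH m n hmn) hn))
        (fun H hH => by
          obtain ⟨_, ⟨n, rfl⟩, hn⟩ := Set.not_subset.1 (hcon H hH)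
          exact ⟨n, fun _ => hn⟩)
      obtain ⟨G, hG, hlt⟩ := hunb (∑ i ∈ Finset.range (K + 1), g i)
      have hq : collectionParam le S G ≤ K :=
        (hle G K).2 fun H hH h => hK H hH hH (hC _ _ h hG)
      obtain ⟨m, hm⟩ := ENat.ne_top_iff_exists.1 (ne_top_of_le_ne_top (ENat.natCast_ne_top K) hq)
      rw [← hm, Nat.cast_le] at hq
      exact absurd ((hg G m hm.symm).trans (Nat.cast_le.2 (hmono g K m hq))) (not_le.2 hlt)
  · rintro ⟨h1, h2⟩
    have hf : ∀ n : ℕ, ∃ K, ∀ H ∈ S, (n : ℕ∞) < p (H K) := by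
      intro n
      obtain ⟨K, hK⟩ := exists_uniform_bound (P := fun H K => H ∈ S → (n : ℕ∞) < p (H K)) hfin
        (fun H m K hmK h hH => (h hH).trans_le (hp _ _ (hS H hH m K hmK)))
        (fun H hH => by
          obtain ⟨_, ⟨K, rfl⟩, hK⟩ := h1 H hH n
          exact ⟨K, fun _ => hK⟩)
      exact ⟨K, fun H hH => hK H hH hH⟩
    choose f hf using hf
    have hg : ∀ n : ℕ, ∃ K : ℕ, ∀ G, collectionParam le S G ≤ n → p G ≤ K := by
      intro n
      have := mt (h2 {G | ∀ H ∈ S, ¬ le (H n) G}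
        (fun G G' hG h H hH h' => h H hH (htrans _ _ _ h' hG)))
        (by
          rintro ⟨H, hH, hsub⟩
          exact hsub ⟨n, rfl⟩ H hH (hrefl _))
      obtain ⟨K, hK⟩ := GraphParam.not_isUnboundedOn.1 this
      exact ⟨K, fun G hG => hK G ((hle G n).1 hG)⟩
    choose g hg using hg
    have hfle : ∀ G (n : ℕ), p G = n → collectionParam le S G ≤ f n := fun G n hG =>
      (hle G (f n)).2 fun H hH h => not_lt.2 ((hp _ _ h).trans hG.le) (hf n H hH)
    refine ⟨⟨fun G hG => ?_, f, hfle⟩, fun G hG => ?_, g, fun G n hG => hg n G hG.le⟩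
    · obtain ⟨n, hn⟩ := ENat.ne_top_iff_exists.1 hG
      exact ne_top_of_le_ne_top (ENat.natCast_ne_top _) (hfle G n hn.symm)
    · obtain ⟨n, hn⟩ := ENat.ne_top_iff_exists.1 hG
      exact ne_top_of_le_ne_top (ENat.natCast_ne_top _) (hg n G hn.symm.le)

theorem GraphSeq.IsMonotone.isPrime {H : GraphSeq} (hH : H.IsMonotone le) :
    H.IsPrime le := by
  refine ⟨le_antisymm ?_ ?_, hH⟩
  · refine iSup_le fun A => iSup₂_le fun hA hanti => Set.encard_le_one_iff.2 fun a b ha hb => ?_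
    by_contra hab
    obtain ⟨i, rfl⟩ := hA ha
    obtain ⟨j, rfl⟩ := hA hb
    rcases le_total i j with h | h
    · exact hanti ha hb hab (hH i j h)
    · exact hanti hb ha (Ne.symm hab) (hH j i h)
  · refine le_iSup_of_le {H 0} (le_iSup₂_of_le ?_ ?_ ?_)
    · simp
    · exact Set.pairwise_singleton _ _
    · simp

/-! ### A parameter without finite obstructions in the presence of the Rado structure -/

/-- In a copy `ρ` of the Rado structure, the largest second index of a pair below `G`. -/
noncomputable def radoParam (le : FinGraph → FinGraph → Prop) (ρ : RadoPair → FinGraph) :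
    GraphParam :=
  fun G => ⨆ (x : RadoPair) (_ : le (ρ x) G), (x.1.2 : ℕ∞)

/-- The lower class generated by each row of the Rado structure contains a sequence of the
obstruction, and the parameter is bounded on the intersection of two such classes. So there are
infinitely many sequences in the obstruction. -/
theorem radoParam_no_finite_obstruction (hrefl : ∀ G, le G G)
    (htrans : ∀ F G H, le F G → le G H → le F H) (ρ : radoLE ↪r le) (hfin : S.Finite) :
    ¬ IsUniversalObstruction le S (radoParam le ρ) := by
  rintro ⟨⟨-, hprime, -⟩, hequiv⟩
  have hp : (radoParam le ρ).IsMonotone le := fun H G h =>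
    iSup₂_le fun x hx => le_iSup₂_of_le x (htrans _ _ _ hx h) le_rfl
  obtain ⟨h1, h2⟩ := (collectionParam_asympEquiv_iff hrefl htrans hp hfin
    fun H hH => (hprime H hH).2).1 hequiv
  have hrow : ∀ i : ℕ, ∃ H ∈ S, Set.range H ⊆ {G | ∃ x : RadoPair, x.1.1 = i ∧ le G (ρ x)} := by
    intro i
    refine h2 _ (fun H G h ⟨x, hx, hG⟩ => ⟨x, hx, htrans _ _ _ h hG⟩) fun n => ?_
    let x : RadoPair := ⟨(i, i + n + 1), by simp only; omega⟩
    refine ⟨ρ x, ⟨x, rfl, hrefl _⟩, ?_⟩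
    refine lt_of_lt_of_le ?_ (le_iSup₂_of_le x (hrefl _) le_rfl)
    exact Nat.cast_lt.2 (by simp only [x]; omega)
  choose s hs hsub using hrow
  have hinj : Function.Injective s := by
    intro i j hij
    by_contra hne
    wlog hlt : i < j generalizing i j
    · exact this hij.symm (Ne.symm hne) (by omega)
    obtain ⟨_, ⟨n, rfl⟩, hn⟩ := h1 (s i) (hs i) j
    refine absurd hn (not_lt.2 (iSup₂_le fun x hx => Nat.cast_le.2 ?_))
    obtain ⟨y, hy, hy'⟩ := hsub i ⟨n, rfl⟩
    obtain ⟨z, hz, hz'⟩ := hsub j ⟨n, congrFun hij.symm n⟩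
    have hxy : radoLE x y := ρ.map_rel_iff.1 (htrans _ _ _ hx hy')
    have hxz : radoLE x z := ρ.map_rel_iff.1 (htrans _ _ _ hx hz')
    have := x.2
    simp only [radoLE] at hxy hxz
    omega
  exact hfin.not_infinite ((Set.infinite_range_of_injective hinj).mono
    (by rintro _ ⟨i, rfl⟩; exact hs i))

/-! ### Minimal unbounded lower classes -/

theorem wellFounded_isLowerClass (hwqo : WellQuasiOrdered le) :
    WellFounded fun C D : {C // IsLowerClass le C} => C.1 ⊂ D.1 := by
  rw [RelEmbedding.wellFounded_iff_isEmpty]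
  refine ⟨fun f => ?_⟩
  have hanti : StrictAnti fun n => (f n).1 :=
    strictAnti_nat_of_succ_lt fun n => f.map_rel_iff.2 (Nat.lt_succ_self n)
  have : ∀ n, ∃ G ∈ (f n).1, G ∉ (f (n + 1)).1 := fun n =>
    Set.exists_of_ssubset (hanti (Nat.lt_succ_self n))
  choose x hx hx' using this
  obtain ⟨m, n, hmn, hle⟩ := hwqo x
  exact hx' m ((f (m + 1)).2 _ _ hle (hanti.antitone (Nat.succ_le_of_lt hmn) (hx n)))

/-- The lower class `C` is minimal among those on which `p` is unbounded. -/
structure IsMinimalUnbounded (le : FinGraph → FinGraph → Prop) (p : GraphParam)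
    (C : Set FinGraph) : Prop where
  lower : IsLowerClass le C
  unbounded : p.IsUnboundedOn C
  eq_of_subset : ∀ D, IsLowerClass le D → p.IsUnboundedOn D → D ⊆ C → D = C

theorem exists_isMinimalUnbounded_subset (hwqo : WellQuasiOrdered le) {C : Set FinGraph}
    (hC : IsLowerClass le C) (hunb : p.IsUnboundedOn C) :
    ∃ D, IsMinimalUnbounded le p D ∧ D ⊆ C := by
  obtain ⟨D, ⟨hD, hDC⟩, hmin⟩ := (wellFounded_isLowerClass hwqo).has_min
    {D | p.IsUnboundedOn D.1 ∧ D.1 ⊆ C} ⟨⟨C, hC⟩, hunb, subset_rfl⟩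
  refine ⟨D.1, ⟨D.2, hD, fun E hE hEunb hED => ?_⟩, hDC⟩
  by_contra hne
  exact hmin ⟨E, hE⟩ ⟨hEunb, hED.trans hDC⟩ (hED.ssubset_of_ne hne)

theorem finite_setOf_isMinimalUnbounded (htrans : ∀ F G H, le F G → le G H → le F H)
    (h : IsOmegaSqWqo le) : {C | IsMinimalUnbounded le p C}.Finite := by
  by_contra hinf
  let D := Set.Infinite.natEmbedding _ hinf
  obtain ⟨ρ⟩ := nonempty_radoLE_relEmbedding htrans h.1 (fun i => (D i).1)
    (fun i => IsMinimalUnbounded.lower (D i).2) fun i j hij hsub => hij.ne (D.injective (Subtype.ext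
      (IsMinimalUnbounded.eq_of_subset (D j).2 _ (IsMinimalUnbounded.lower (D i).2)
        (IsMinimalUnbounded.unbounded (D i).2) hsub)))
  exact h.2.false ρ

/-- If `C` is not directed, it is the union of two smaller lower classes, so that `p` is unbounded
on one of these. -/
theorem IsMinimalUnbounded.directed (hrefl : ∀ G, le G G)
    (htrans : ∀ F G H, le F G → le G H → le F H) {C : Set FinGraph}
    (hC : IsMinimalUnbounded le p C) :
    ∀ x ∈ C, ∀ y ∈ C, ∃ z ∈ C, le x z ∧ le y z := by
  intro x hx y hy
  by_contra! hcon
  have key : ∀ w ∈ C, ∃ n : ℕ, ∀ G ∈ C, ¬ le w G → p G ≤ n := by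
    intro w hw
    have : ¬ p.IsUnboundedOn {G | G ∈ C ∧ ¬ le w G} := fun hunb => by
      have heq := hC.eq_of_subset {G | G ∈ C ∧ ¬ le w G}
        (fun H G h hG => ⟨hC.lower _ _ h hG.1, fun h' => hG.2 (htrans _ _ _ h' h)⟩) hunb
        fun G hG => hG.1
      exact (heq.symm ▸ hw : w ∈ {G | G ∈ C ∧ ¬ le w G}).2 (hrefl w)
    obtain ⟨n, hn⟩ := GraphParam.not_isUnboundedOn.1 this
    exact ⟨n, fun G hG h => hn G ⟨hG, h⟩⟩
  obtain ⟨m, hm⟩ := key x hx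
  obtain ⟨n, hn⟩ := key y hy
  refine GraphParam.not_isUnboundedOn.2 ⟨max m n, fun G hG => ?_⟩ hC.unbounded
  by_cases h : le x G
  · exact (hn G hG (hcon G hG h)).trans (Nat.cast_le.2 (le_max_right _ _))
  · exact (hm G hG h).trans (Nat.cast_le.2 (le_max_left _ _))

theorem IsMinimalUnbounded.nonempty {C : Set FinGraph} (hC : IsMinimalUnbounded le p C) :
    C.Nonempty :=
  let ⟨G, hG, _⟩ := hC.unbounded 0
  ⟨G, hG⟩

/-- Sequences cofinal in the minimal unbounded lower classes form a universal obstruction. -/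
theorem isUniversalObstruction_of_cofinal (hrefl : ∀ G, le G G)
    (htrans : ∀ F G H, le F G → le G H → le F H) (h : IsOmegaSqWqo le) (hp : p.IsMonotone le)
    (s : Set FinGraph → GraphSeq) (hs : ∀ C, IsMinimalUnbounded le p C →
      (s C).IsMonotone le ∧ (∀ k, s C k ∈ C) ∧ ∀ G ∈ C, ∃ k, le G (s C k)) :
    IsUniversalObstruction le (s '' {C | IsMinimalUnbounded le p C}) p := by
  have hfin := (finite_setOf_isMinimalUnbounded (p := p) htrans h).image s
  have hmon : ∀ H ∈ s '' {C | IsMinimalUnbounded le p C}, GraphSeq.IsMonotone le H := by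
    rintro _ ⟨C, hC, rfl⟩
    exact (hs C hC).1
  refine ⟨⟨hfin.countable, fun H hH => (hmon H hH).isPrime, ?_⟩,
    (collectionParam_asympEquiv_iff hrefl htrans hp hfin hmon).2 ⟨?_, ?_⟩⟩
  · rintro _ ⟨C, hC : IsMinimalUnbounded le p C, rfl⟩ _ ⟨D, hD : IsMinimalUnbounded le p D, rfl⟩
      hne ⟨f, hf⟩
    refine hne (congrArg s (hD.eq_of_subset C hC.lower hC.unbounded fun G hG => ?_))
    obtain ⟨k, hk⟩ := (hs C hC).2.2 G hG
    exact hD.lower _ _ (htrans _ _ _ hk (hf k)) ((hs D hD).2.1 _)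
  · rintro _ ⟨C, hC : IsMinimalUnbounded le p C, rfl⟩ n
    obtain ⟨G, hG, hn⟩ := hC.unbounded n
    obtain ⟨k, hk⟩ := (hs C hC).2.2 G hG
    exact ⟨s C k, ⟨k, rfl⟩, hn.trans_le (hp _ _ hk)⟩
  · intro C hC hunb
    obtain ⟨D, hD, hDC⟩ := exists_isMinimalUnbounded_subset h.1 hC hunb
    refine ⟨s D, ⟨D, hD, rfl⟩, ?_⟩
    rintro _ ⟨k, rfl⟩
    exact hDC ((hs D hD).2.1 k)

end Obstructions

/-! ### Stack machines compute recursive functions -/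

theorem Primrec.curry_finite {α β σ : Type*} [Primcodable α] [Primcodable β] [Primcodable σ]
    [Finite α] {f : α → β → σ} (hf : ∀ a, Primrec (f a)) : Primrec₂ f := by
  obtain ⟨n, ⟨e⟩⟩ := Finite.exists_equiv_fin α
  have h : Primrec₂ fun i : Fin n => f (e.symm i) := Primrec.fin_curry₁.2 fun i => hf _
  exact (h.comp₂ ((Primrec.dom_finite e).comp₂ Primrec₂.left) Primrec₂.right).of_eq
    fun a => by simp

theorem Primrec.update_fin {α σ : Type*} [Primcodable α] [Primcodable σ] {n : ℕ}
    {f : α → Fin n → σ} {g : α → σ} (i : Fin n) (hf : Primrec f) (hg : Primrec g) :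
    Primrec fun a => Function.update (f a) i (g a) := by
  refine Primrec.fin_curry.2 (Primrec₂.swap (Primrec.fin_curry₁.2 fun j => ?_))
  by_cases hj : j = i
  · subst hj
    simpa using hg
  · simpa [Function.update_of_ne hj] using
      (Primrec.fin_app.comp hf (Primrec.const j) : Primrec fun a => f a j)

/-- Unbounded search for a value which is known to exist. -/
theorem exists_computable_search {α : Type*} [Primcodable α] {p : α → ℕ → Bool}
    (hp : Computable₂ p) (h : ∀ a, ∃ n, p a n = true) :
    ∃ f : α → ℕ, Computable f ∧ ∀ a, p a (f a) = true := by
  have hpart : Partrec fun a => Nat.rfind fun n => Part.some (p a n) := Partrec.rfind hp.partrec₂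
  have hdom : ∀ a, (Nat.rfind fun n => Part.some (p a n)).Dom := fun a =>
    let ⟨n, hn⟩ := h a
    Nat.rfind_dom.2 ⟨n, by simp [hn], by simp⟩
  refine ⟨fun a => Part.get _ (hdom a), hpart.of_eq_tot fun a => Part.get_mem _, fun a => ?_⟩
  simpa using Nat.rfind_spec (Part.get_mem (hdom a))

/-- An arbitrary coding of a finite type. -/
noncomputable abbrev Primcodable.ofFinite (α : Type*) [Finite α] : Primcodable α :=
  Primcodable.ofEquiv (Fin (Nat.card α)) (Finite.equivFin α)

namespace StackMachine

open Turing TM2 Function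

variable {K : Type*} {Γ : K → Type*} {Λ σ T : Type*} {c : ℕ}

/-- The symbols, tagged with their stack, which a statement may push. -/
def pushed : Stmt Γ Λ σ → Set (Σ k, Γ k)
  | .push k f q => Set.range (fun v => ⟨k, f v⟩) ∪ pushed q
  | .peek _ _ q => pushed q
  | .pop _ _ q => pushed q
  | .load _ q => pushed q
  | .branch _ q₁ q₂ => pushed q₁ ∪ pushed q₂
  | .goto _ => ∅
  | .halt => ∅

theorem finite_pushed [Finite σ] (q : Stmt Γ Λ σ) : (pushed q).Finite := by
  induction q with
  | push k f q ih => exact (Set.finite_range _).union ih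
  | peek k f q ih => exact ih
  | pop k f q ih => exact ih
  | load f q ih => exact ih
  | branch f q₁ q₂ ih₁ ih₂ => exact ih₁.union ih₂
  | goto f => exact Set.finite_empty
  | halt => exact Set.finite_empty

/-- The execution of a statement, with stacks over the code alphabet `T` numbered by `Fin c`. -/
def codedStepAux (e : K ≃ Fin c) (code : (Σ k, Γ k) → T) (dec : ∀ k, T → Option (Γ k)) :
    Stmt Γ Λ σ → σ × (Fin c → List T) → Option Λ × σ × (Fin c → List T)
  | .push k f q, x =>
    codedStepAux e code dec q (x.1, update x.2 (e k) (code ⟨k, f x.1⟩ :: x.2 (e k)))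
  | .peek k f q, x => codedStepAux e code dec q (f x.1 ((x.2 (e k)).head?.bind (dec k)), x.2)
  | .pop k f q, x => codedStepAux e code dec q
      (f x.1 ((x.2 (e k)).head?.bind (dec k)), update x.2 (e k) (x.2 (e k)).tail)
  | .load f q, x => codedStepAux e code dec q (f x.1, x.2)
  | .branch f q₁ q₂, x => cond (f x.1) (codedStepAux e code dec q₁ x) (codedStepAux e code dec q₂ x)
  | .goto f, x => (some (f x.1), x)
  | .halt, x => (none, x)

/-- One step of the coded machine; halting configurations are fixed points. -/
def codedStep (e : K ≃ Fin c) (code : (Σ k, Γ k) → T) (dec : ∀ k, T → Option (Γ k))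
    (m : Λ → Stmt Γ Λ σ) :
    Option Λ → σ × (Fin c → List T) → Option Λ × σ × (Fin c → List T)
  | none, x => (none, x)
  | some l, x => codedStepAux e code dec (m l) x

/-- A configuration of the coded machine represents one of the original machine: stack symbols are
compared by decoding. -/
def Represents (e : K ≃ Fin c) (dec : ∀ k, T → Option (Γ k))
    (x : Option Λ × σ × (Fin c → List T)) (C : Cfg Γ Λ σ) : Prop :=
  x.1 = C.l ∧ x.2.1 = C.var ∧ ∀ k, (x.2.2 (e k)).map (dec k) = (C.stk k).map some

section Simulation

variable [DecidableEq K] {e : K ≃ Fin c} {code : (Σ k, Γ k) → T} {dec : ∀ k, T → Option (Γ k)}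

theorem represents_codedStepAux (q : Stmt Γ Λ σ)
    (hq : ∀ y ∈ pushed q, dec y.1 (code y) = some y.2) (v : σ) (S : ∀ k, List (Γ k))
    (S' : Fin c → List T) (hS : ∀ k, (S' (e k)).map (dec k) = (S k).map some) :
    Represents e dec (codedStepAux e code dec q (v, S')) (stepAux q v S) := by
  have hupdate : ∀ (S : ∀ k, List (Γ k)) (S' : Fin c → List T),
      (∀ k, (S' (e k)).map (dec k) = (S k).map some) →
      ∀ (k) (s : List (Γ k)) (s' : List T), s'.map (dec k) = s.map some →
      ∀ k', (update S' (e k) s' (e k')).map (dec k') = (update S k s k').map some := by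
    intro S S' hS k s s' hs k'
    by_cases h : k' = k
    · subst h
      simpa using hs
    · rw [update_of_ne h, update_of_ne (e.injective.ne h), hS]
  have hhead : ∀ (k) (s : List (Γ k)) (s' : List T), s'.map (dec k) = s.map some →
      s'.head?.bind (dec k) = s.head? ∧ s'.tail.map (dec k) = s.tail.map some := by
    intro k s s' h
    cases s <;> cases s' <;> simp_all
  induction q generalizing v S S' with
  | push k f q ih =>
    refine ih (fun y hy => hq y (Or.inr hy)) _ _ _ (hupdate S S' hS k _ _ ?_)
    simp only [List.map_cons, hS, hq ⟨k, f v⟩ (Or.inl ⟨v, rfl⟩)]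
  | peek k f q ih =>
    rw [codedStepAux, stepAux, (hhead k _ _ (hS k)).1]
    exact ih hq _ _ _ hS
  | pop k f q ih =>
    rw [codedStepAux, stepAux, (hhead k _ _ (hS k)).1]
    exact ih hq _ _ _ (hupdate S S' hS k _ _ (hhead k _ _ (hS k)).2)
  | load f q ih => exact ih hq _ _ _ hS
  | branch f q₁ q₂ ih₁ ih₂ =>
    rw [codedStepAux, stepAux]
    cases f v
    · exact ih₂ (fun y hy => hq y (Or.inr hy)) _ _ _ hS
    · exact ih₁ (fun y hy => hq y (Or.inl hy)) _ _ _ hS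
  | goto f => exact ⟨rfl, rfl, hS⟩
  | halt => exact ⟨rfl, rfl, hS⟩

theorem represents_iterate {m : Λ → Stmt Γ Λ σ}
    (hm : ∀ l, ∀ y ∈ pushed (m l), dec y.1 (code y) = some y.2)
    {x : Option Λ × σ × (Fin c → List T)} {C : Cfg Γ Λ σ} (hx : Represents e dec x C) (n : ℕ)
    {C' : Cfg Γ Λ σ} (hC' : (flip bind (step m))^[n] (some C) = some C') :
    Represents e dec ((fun y => codedStep e code dec m y.1 y.2)^[n] x) C' := by
  induction n generalizing C' with
  | zero =>
    obtain rfl : C = C' := Option.some.inj hC'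
    exact hx
  | succ n ih =>
    rw [iterate_succ_apply'] at hC' ⊢
    obtain ⟨C₁, h₁, h₂⟩ := Option.bind_eq_some_iff.1 hC'
    obtain ⟨hl, hv, hS⟩ := ih h₁
    obtain ⟨l, v, S⟩ := C₁
    cases l with
    | none => exact absurd h₂ (by simp [step])
    | some l =>
      obtain rfl : stepAux (m l) v S = C' := Option.some.inj h₂
      generalize (fun y => codedStep e code dec m y.1 y.2)^[n] x = y at hl hv hS ⊢
      obtain ⟨l', v', S'⟩ := y
      obtain rfl : l' = some l := hl
      obtain rfl : v' = v := hv
      exact represents_codedStepAux _ (hm l) _ _ _ hS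

end Simulation

section Computability

variable [Primcodable Λ] [Primcodable σ] [Finite σ] [Primcodable T] [Finite T]
  (e : K ≃ Fin c) (code : (Σ k, Γ k) → T) (dec : ∀ k, T → Option (Γ k))

theorem primrec_codedStepAux (q : Stmt Γ Λ σ) : Primrec (codedStepAux e code dec q) := by
  have hstk : ∀ k, Primrec fun x : σ × (Fin c → List T) => x.2 (e k) := fun k =>
    Primrec.fin_app.comp Primrec.snd (Primrec.const (e k))
  have hvar : ∀ k (f : σ → Option (Γ k) → σ), Primrec fun x : σ × (Fin c → List T) =>
      f x.1 ((x.2 (e k)).head?.bind (dec k)) := fun k f =>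
    (Primrec.dom_finite fun y : σ × Option T => f y.1 (y.2.bind (dec k))).comp
      (Primrec.fst.pair (Primrec.list_head?.comp (hstk k)))
  induction q with
  | push k f q ih =>
    exact ih.comp (Primrec.fst.pair (Primrec.update_fin _ Primrec.snd (Primrec.list_cons.comp
      ((Primrec.dom_finite fun v => code ⟨k, f v⟩).comp Primrec.fst) (hstk k))))
  | peek k f q ih => exact ih.comp ((hvar k f).pair Primrec.snd)
  | pop k f q ih =>
    exact ih.comp ((hvar k f).pair
      (Primrec.update_fin _ Primrec.snd (Primrec.list_tail.comp (hstk k))))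
  | load f q ih => exact ih.comp (((Primrec.dom_finite f).comp Primrec.fst).pair Primrec.snd)
  | branch f q₁ q₂ ih₁ ih₂ =>
    exact Primrec.cond ((Primrec.dom_finite f).comp Primrec.fst) ih₁ ih₂
  | goto f =>
    exact ((Primrec.dom_finite fun v => some (f v)).comp Primrec.fst).pair Primrec.id
  | halt => exact (Primrec.const none).pair Primrec.id

theorem primrec_codedStep [Finite Λ] (m : Λ → Stmt Γ Λ σ) :
    Primrec fun x : Option Λ × σ × (Fin c → List T) => codedStep e code dec m x.1 x.2 :=
  Primrec.curry_finite fun l => match l with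
    | none => (Primrec.const none).pair Primrec.id
    | some l => primrec_codedStepAux e code dec (m l)

end Computability

theorem codedStep_iterate_of_halted {e : K ≃ Fin c} {code : (Σ k, Γ k) → T}
    {dec : ∀ k, T → Option (Γ k)} (m : Λ → Stmt Γ Λ σ) {x : Option Λ × σ × (Fin c → List T)}
    (hx : x.1 = none) (n : ℕ) : (fun y => codedStep e code dec m y.1 y.2)^[n] x = x := by
  refine iterate_fixed ?_ n
  obtain ⟨l, x⟩ := x
  obtain rfl : l = none := hx
  rfl

/-- A code alphabet for a finite set `F` of tagged symbols. -/
theorem exists_code {K : Type} {Γ : K → Type} (F : Set (Σ k, Γ k)) (hF : F.Finite) :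
    ∃ (T : Type) (_ : Finite T) (code : (Σ k, Γ k) → T) (dec : ∀ k, T → Option (Γ k)),
      ∀ y ∈ F, dec y.1 (code y) = some y.2 := by
  classical
  have := hF.to_subtype
  refine ⟨Option F, inferInstance, fun y => if h : y ∈ F then some ⟨y, h⟩ else none,
    fun k t => t.bind fun y => if h : y.1.1 = k then some (h ▸ y.1.2) else none, ?_⟩
  intro y hy
  simp [hy]

end StackMachine

open StackMachine in
/-- A function computed by a multi-stack Turing machine is recursive: run the machine until it
halts. The alphabets of the auxiliary stacks may be infinite, but only finitely many of their
symbols ever occur. -/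
theorem computable_of_tm2Outputs {α Γ : Type} [Primcodable α] [Primcodable Γ] [Finite Γ]
    (M : Turing.TM2ComputableAux Γ Bool) {w : α → List Γ} (hw : Computable w) (Q : α → Bool)
    (h : ∀ a, Nonempty (Turing.TM2Outputs M.tm ((w a).map M.inputAlphabet.invFun)
      (some ([Q a].map M.outputAlphabet.invFun)))) : Computable Q := by
  obtain ⟨tm, inp, out⟩ := M
  have := tm.kFin
  have := tm.ΛFin
  have := tm.σFin
  have := tm.Γk₀Fin
  let F : Set (Σ k, tm.Γ k) := (⋃ l, pushed (tm.m l)) ∪ Set.range (Sigma.mk tm.k₀)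
  obtain ⟨T, _, code, dec, hdec⟩ := exists_code F
    ((Set.finite_iUnion fun l => finite_pushed _).union (Set.finite_range _))
  let _ := Primcodable.ofFinite tm.Λ
  let _ := Primcodable.ofFinite tm.σ
  let _ := Primcodable.ofFinite T
  let e := Finite.equivFin tm.K
  let init : List Γ → Option tm.Λ × tm.σ × (Fin (Nat.card tm.K) → List T) := fun s =>
    (some tm.main, tm.initialState,
      Function.update (fun _ => []) (e tm.k₀) (s.map fun g => code ⟨tm.k₀, inp.symm g⟩))
  have hinit : Primrec init := (Primrec.const _).pair ((Primrec.const _).pair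
    (Primrec.update_fin _ (Primrec.const _) (Primrec.list_map Primrec.id
      ((Primrec.dom_finite fun g => code ⟨tm.k₀, inp.symm g⟩).comp₂ Primrec₂.right))))
  let run : List Γ → ℕ → Option tm.Λ × tm.σ × (Fin (Nat.card tm.K) → List T) := fun s n =>
    (fun y => codedStep e code dec tm.m y.1 y.2)^[n] (init s)
  have hrun : Primrec₂ run := Primrec.nat_iterate Primrec.snd (hinit.comp Primrec.fst)
    ((primrec_codedStep e code dec tm.m).comp₂ Primrec₂.right)
  have hrep : ∀ s, Represents e dec (init s) (Turing.initList tm (s.map inp.invFun)) := by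
    refine fun s => ⟨rfl, rfl, fun k => ?_⟩
    by_cases hk : k = tm.k₀
    · subst hk
      simp [init, Turing.initList, hdec _ (Or.inr ⟨_, rfl⟩ : (⟨tm.k₀, _⟩ : Σ k, tm.Γ k) ∈ F)]
    · simp [init, Turing.initList, hk]
  let result : T → Bool := fun t => (dec tm.k₁ t).elim false out
  let answer : Option tm.Λ × tm.σ × (Fin (Nat.card tm.K) → List T) → Bool := fun x =>
    (x.2.2 (e tm.k₁)).head?.elim false result
  have hanswer : Primrec answer :=
    (Primrec.dom_finite fun o : Option T => o.elim false result).comp (Primrec.list_head?.comp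
      (Primrec.fin_app.comp (Primrec.snd.comp Primrec.snd) (Primrec.const (e tm.k₁))))
  have hhalt : ∀ a, ∃ n, (run (w a) n).1 = none ∧ answer (run (w a) n) = Q a := by
    intro a
    obtain ⟨n, hn⟩ := h a
    obtain ⟨h₁, -, h₂⟩ := represents_iterate (code := code)
      (fun l y hy => hdec y (Or.inl (Set.mem_iUnion.2 ⟨l, hy⟩))) (hrep (w a)) n hn
    refine ⟨n, h₁, ?_⟩
    have h₃ := h₂ tm.k₁
    simp only [Turing.haltList, List.map_cons, List.map_nil] at h₃
    change List.map (dec tm.k₁) ((run (w a) n).2.2 (e tm.k₁)) = [some (out.symm (Q a))] at h₃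
    obtain ⟨t, ht, htd⟩ := List.map_eq_singleton_iff.1 h₃
    simp [answer, ht, result, htd]
  have hr : Computable₂ fun a n => run (w a) n :=
    hrun.to_comp.comp₂ (hw.comp₂ Computable.fst.to₂) Computable.snd.to₂
  obtain ⟨f, hf, hfh⟩ := exists_computable_search (p := fun a n => (run (w a) n).1.isNone)
    (Computable.comp₂ (Primrec.dom_finite _).to_comp (Computable.fst.comp₂ hr))
    fun a => (hhalt a).imp fun n hn => by simp [hn.1]
  have hfixed : ∀ s m n, (run s m).1 = none → m ≤ n → run s n = run s m := by
    intro s m n hm hmn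
    obtain ⟨d, rfl⟩ := Nat.exists_eq_add_of_le' hmn
    exact (Function.iterate_add_apply _ d m _).trans (codedStep_iterate_of_halted _ hm d)
  refine (hanswer.to_comp.comp (hr.comp Computable.id hf)).of_eq fun a => ?_
  obtain ⟨n, hn, hQ⟩ := hhalt a
  have hfa : (run (w a) (f a)).1 = none := by simpa using hfh a
  rw [← hQ]
  rcases le_total n (f a) with h | h
  · exact congrArg answer (hfixed _ _ _ hn h)
  · exact congrArg answer (hfixed _ _ _ hfa h).symm

/-! ### Coding graphs by edge lists -/

/-- The code of a graph: the number of vertices and a list of edges, in either orientation. Loops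
and pairs out of range are allowed in the list and mean nothing. -/
abbrev GraphCode : Type := ℕ × List (ℕ × ℕ)

/-- The graph with the given code. -/
def GraphCode.graph (a : GraphCode) : FinGraph :=
  ⟨a.1, SimpleGraph.fromRel fun i j => (i.1, j.1) ∈ a.2⟩

theorem GraphCode.graph_surjective : Function.Surjective GraphCode.graph := by
  classical
  rintro ⟨n, G⟩
  refine ⟨(n, ((Finset.univ : Finset (Fin n × Fin n)).filter
    fun x => G.Adj x.1 x.2).toList.map fun x => (x.1.1, x.2.1)), ?_⟩
  refine congrArg (Sigma.mk n) ?_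
  ext i j
  have key : ∀ i j : Fin n, (∃ x : Fin n × Fin n, G.Adj x.1 x.2 ∧ (x.1.1, x.2.1) = (i.1, j.1)) ↔
      G.Adj i j := by
    intro i j
    constructor
    · rintro ⟨⟨k, l⟩, h, heq⟩
      obtain ⟨h1, h2⟩ := Prod.mk.inj heq
      rwa [← Fin.ext h1, ← Fin.ext h2]
    · exact fun h => ⟨(i, j), h, rfl⟩
  simp only [SimpleGraph.fromRel_adj, List.mem_map, Finset.mem_toList, Finset.mem_filter,
    Finset.mem_univ, true_and, key]
  exact ⟨fun h => h.2.elim id SimpleGraph.Adj.symm, fun h => ⟨h.ne, Or.inl h⟩⟩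

theorem GraphCode.primrec_encode : Primrec fun a : GraphCode => a.graph.encode := by
  classical
  have hadj : PrimrecPred fun x : (GraphCode × ℕ) × ℕ =>
      x.1.2 ≠ x.2 ∧ ((x.1.2, x.2) ∈ x.1.1.2 ∨ (x.2, x.1.2) ∈ x.1.1.2) := by
    have hmem : PrimrecRel fun (L : List (ℕ × ℕ)) (y : ℕ × ℕ) => y ∈ L :=
      (PrimrecRel.exists_mem_list (R := fun a b : ℕ × ℕ => a = b) Primrec.eq).of_eq (by simp)
    have hi : Primrec fun x : (GraphCode × ℕ) × ℕ => x.1.2 := Primrec.snd.comp Primrec.fst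
    have hj : Primrec fun x : (GraphCode × ℕ) × ℕ => x.2 := Primrec.snd
    have hL : Primrec fun x : (GraphCode × ℕ) × ℕ => x.1.1.2 :=
      Primrec.snd.comp (Primrec.fst.comp Primrec.fst)
    exact (Primrec.eq.comp hi hj).not.and
      ((hmem.comp hL (hi.pair hj)).or (hmem.comp hL (hj.pair hi)))
  have hentry : Primrec fun x : (GraphCode × ℕ) × ℕ => (Sum.inl (decide
      (x.1.2 ≠ x.2 ∧ ((x.1.2, x.2) ∈ x.1.1.2 ∨ (x.2, x.1.2) ∈ x.1.1.2))) : GraphLetter) :=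
    Primrec.sumInl.comp hadj.decide
  have hrow := Primrec.list_append.comp
    (Primrec.list_map (Primrec.list_range.comp (Primrec.fst.comp Primrec.fst)) hentry.to₂)
    (Primrec.const ([Sum.inr false] : List GraphLetter))
  have h := Primrec.list_append.comp
    (Primrec.list_flatMap (Primrec.list_range.comp Primrec.fst) hrow.to₂)
    (Primrec.const ([Sum.inr true] : List GraphLetter))
  refine h.of_eq fun a => ?_
  simp only [FinGraph.encode, GraphCode.graph, SimpleGraph.fromRel_adj,
    ← List.map_coe_finRange_eq_range, List.flatMap_map, List.map_map, Function.comp_def, ne_eq,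
    Fin.ext_iff]

/-- An enumeration of all graphs. -/
def enumGraph (n : ℕ) : FinGraph := (Denumerable.ofNat GraphCode n).graph

theorem enumGraph_surjective : Function.Surjective enumGraph := fun G =>
  let ⟨a, ha⟩ := GraphCode.graph_surjective G
  ⟨Encodable.encode a, by rw [enumGraph, Denumerable.ofNat_encode, ha]⟩

theorem computable_encode_enumGraph : Computable fun n => (enumGraph n).encode :=
  GraphCode.primrec_encode.to_comp.comp (Computable.ofNat GraphCode)

theorem computable_encodeGraphs {β : Type*} [Primcodable β] (L : List (β → ℕ))
    (hL : ∀ f ∈ L, Computable f) :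
    Computable fun b => encodeGraphs (L.map fun f => enumGraph (f b)) := by
  induction L with
  | nil => exact Computable.const []
  | cons f L ih =>
    simp only [encodeGraphs, List.map_cons, List.flatMap_cons] at ih ⊢
    exact Computable.list_append.comp (computable_encode_enumGraph.comp (hL f (by simp)))
      (ih fun g hg => hL g (by simp [hg]))

open Classical in
theorem IsFPTDecidable.computable₂ {le : FinGraph → FinGraph → Prop} (h : IsFPTDecidable le) :
    Computable₂ fun m n => decide (le (enumGraph m) (enumGraph n)) := by
  obtain ⟨M, f, c, hM⟩ := h
  exact computable_of_tm2Outputs M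
    (w := fun x : ℕ × ℕ => encodeGraphs [enumGraph x.1, enumGraph x.2])
    (computable_encodeGraphs [Prod.fst, Prod.snd] (by simp [Computable.fst, Computable.snd])) _
    fun x => (hM (enumGraph x.1, enumGraph x.2)).map fun h => h.toTM2Outputs

theorem isEffective_image_enumGraph {T : Set (ℕ → ℕ)} (hfin : T.Finite)
    (hT : ∀ f ∈ T, Computable f) : IsEffective ((fun f k => enumGraph (f k)) '' T) := by
  refine ⟨hfin.image _, fun k => hfin.toFinset.toList.map fun f => enumGraph (f k), fun k => ?_, ?_⟩
  · ext G
    simp [eq_comm]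
  · exact computable_encodeGraphs _ fun f hf => hT f (by simpa using hf)

/-! ### Computable cofinal sequences -/

section Cofinal

variable {le : FinGraph → FinGraph → Prop} {C : Set FinGraph}

open Classical in
/-- Membership in a lower class of a decidable well-quasi-order is decidable, because the class is
determined by finitely many excluded graphs. -/
theorem computable_mem_of_isLowerClass (hrefl : ∀ G, le G G)
    (htrans : ∀ F G H, le F G → le G H → le F H) (hwqo : WellQuasiOrdered le)
    (hcomp : Computable₂ fun m n => decide (le (enumGraph m) (enumGraph n)))
    (hC : IsLowerClass le C) : Computable fun n => decide (enumGraph n ∈ C) := by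
  -- The classes excluding the graphs outside `C` among the first `N` graphs decrease to `C`.
  let W : ℕ → Set FinGraph := fun N => {G | ∀ j < N, enumGraph j ∉ C → ¬ le (enumGraph j) G}
  have hW : ∀ N, IsLowerClass le (W N) := fun N H G h hG j hj hjC h' =>
    hG j hj hjC (htrans _ _ _ h' h)
  have hsucc : ∀ N G, G ∈ W (N + 1) ↔
      G ∈ W N ∧ (enumGraph N ∉ C → ¬ le (enumGraph N) G) := fun N G => Nat.forall_lt_succ_right
  have hWcomp : ∀ N, Computable fun n => decide (enumGraph n ∈ W N) := by
    intro N
    induction N with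
    | zero => exact (Computable.const true).of_eq fun n => by simp [W]
    | succ N ih =>
      by_cases hN : enumGraph N ∈ C
      · refine ih.of_eq fun n => ?_
        simp [hsucc, hN]
      · refine (Primrec.and.to_comp.comp ih (Primrec.not.to_comp.comp
          (hcomp.comp (Computable.const N) Computable.id))).of_eq fun n => ?_
        simp [hsucc, hN]
  obtain ⟨_, ⟨N, rfl⟩, hmin⟩ := (wellFounded_isLowerClass hwqo).has_min
    (Set.range fun N => (⟨W N, hW N⟩ : {C // IsLowerClass le C})) ⟨_, 0, rfl⟩
  have hWC : W N = C := by
    refine Set.Subset.antisymm (fun G hG => ?_) fun G hG j _ hjC h => hjC (hC _ _ h hG)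
    obtain ⟨j, rfl⟩ := enumGraph_surjective G
    by_contra hjC
    refine hmin ⟨W (max N (j + 1)), hW _⟩ ⟨_, rfl⟩ ⟨fun H hH i hi => ?_, fun hsub => ?_⟩
    · exact hH i (hi.trans_le (le_max_left _ _))
    · exact hsub hG j (Nat.lt_of_succ_le (le_max_right _ _)) hjC (hrefl _)
  simpa only [hWC] using hWcomp N

/-- A nonempty directed lower class of a decidable well-quasi-order is generated by a computable
increasing sequence: the next member is found by searching for a member above the last one and, if
it lies in the class, above the next graph of the enumeration. -/
theorem exists_computable_cofinal (hrefl : ∀ G, le G G)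
    (htrans : ∀ F G H, le F G → le G H → le F H) (hwqo : WellQuasiOrdered le)
    (hfpt : IsFPTDecidable le) (hC : IsLowerClass le C) (hne : C.Nonempty)
    (hdir : ∀ x ∈ C, ∀ y ∈ C, ∃ z ∈ C, le x z ∧ le y z) :
    ∃ h : ℕ → ℕ, Computable h ∧ GraphSeq.IsMonotone le (fun k => enumGraph (h k)) ∧
      (∀ k, enumGraph (h k) ∈ C) ∧ ∀ G ∈ C, ∃ k, le G (enumGraph (h k)) := by
  classical
  have hle := hfpt.computable₂
  have hmem := computable_mem_of_isLowerClass hrefl htrans hwqo hle hC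
  let good : ℕ × ℕ → ℕ → Bool := fun x m => !decide (enumGraph x.2 ∈ C) ||
    (decide (enumGraph m ∈ C) && decide (le (enumGraph x.2) (enumGraph m)) &&
      (!decide (enumGraph x.1 ∈ C) || decide (le (enumGraph x.1) (enumGraph m))))
  have hx1 : Computable fun y : (ℕ × ℕ) × ℕ => y.1.1 := Computable.fst.comp Computable.fst
  have hx2 : Computable fun y : (ℕ × ℕ) × ℕ => y.1.2 := Computable.snd.comp Computable.fst
  have hgood : Computable₂ good :=
    Primrec.or.to_comp.comp (Primrec.not.to_comp.comp (hmem.comp hx2))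
      (Primrec.and.to_comp.comp (Primrec.and.to_comp.comp (hmem.comp Computable.snd)
        (hle.comp hx2 Computable.snd)) (Primrec.or.to_comp.comp
          (Primrec.not.to_comp.comp (hmem.comp hx1)) (hle.comp hx1 Computable.snd)))
  obtain ⟨next, hnext, hspec⟩ := exists_computable_search hgood (by
    rintro ⟨k, x⟩
    by_cases hx : enumGraph x ∈ C
    · by_cases hk : enumGraph k ∈ C
      · obtain ⟨z, hz, h1, h2⟩ := hdir _ hx _ hk
        obtain ⟨m, rfl⟩ := enumGraph_surjective z
        exact ⟨m, by simp [good, hz, h1, h2]⟩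
      · exact ⟨x, by simp [good, hx, hk, hrefl]⟩
    · exact ⟨0, by simp [good, hx]⟩)
  have hspec' : ∀ k x, enumGraph x ∈ C → enumGraph (next (k, x)) ∈ C ∧
      le (enumGraph x) (enumGraph (next (k, x))) ∧
      (enumGraph k ∈ C → le (enumGraph k) (enumGraph (next (k, x)))) := by
    intro k x hx
    have := hspec (k, x)
    simp only [good, hx, decide_true, Bool.not_true, Bool.false_or, Bool.and_eq_true,
      decide_eq_true_eq, Bool.or_eq_true, Bool.not_eq_true', decide_eq_false_iff_not] at this
    exact ⟨this.1.1, this.1.2, fun hk => this.2.resolve_left (not_not_intro hk)⟩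
  obtain ⟨_, hG⟩ := hne
  obtain ⟨x₀, rfl⟩ := enumGraph_surjective ‹_›
  let h : ℕ → ℕ := fun n => Nat.rec x₀ (fun k x => next (k, x)) n
  have hh : Computable h := Computable.nat_rec Computable.id (Computable.const x₀)
    (hnext.comp Computable.snd).to₂
  have hhC : ∀ k, enumGraph (h k) ∈ C := by
    intro k
    induction k with
    | zero => exact hG
    | succ k ih => exact (hspec' k _ ih).1
  refine ⟨h, hh, fun i j hij => ?_, hhC, fun G hG => ?_⟩
  · induction j, hij using Nat.le_induction with
    | base => exact hrefl _
    | succ j _ ih => exact htrans _ _ _ ih (hspec' j _ (hhC j)).2.1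
  · obtain ⟨k, rfl⟩ := enumGraph_surjective G
    exact ⟨k + 1, (hspec' k _ (hhC k)).2.2 hG⟩

end Cofinal

/-! ### Effective universal obstructions -/

theorem corollary45 (le : FinGraph → FinGraph → Prop)
    (hrefl : ∀ G : FinGraph, le G G)
    (htrans : ∀ F G H : FinGraph, le F G → le G H → le F H)
    (hwqo : WellQuasiOrdered le)
    (hfpt : IsFPTDecidable le) :
    IsOmegaSqWqo le ↔
      ∀ p : GraphParam, p.IsMonotone le →
        ∃ S : Set GraphSeq, IsUniversalObstruction le S p ∧ IsEffective S := by
  constructor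
  · intro h p hp
    have hseq : ∀ C, ∃ g : ℕ → ℕ, IsMinimalUnbounded le p C → Computable g ∧
        GraphSeq.IsMonotone le (fun k => enumGraph (g k)) ∧
        (∀ k, enumGraph (g k) ∈ C) ∧ ∀ G ∈ C, ∃ k, le G (enumGraph (g k)) := by
      intro C
      by_cases hC : IsMinimalUnbounded le p C
      · obtain ⟨g, hg⟩ := exists_computable_cofinal hrefl htrans hwqo hfpt hC.lower hC.nonempty
          (hC.directed hrefl htrans)
        exact ⟨g, fun _ => hg⟩
      · exact ⟨id, fun hC' => absurd hC' hC⟩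
    choose g hg using hseq
    have hfin := finite_setOf_isMinimalUnbounded (p := p) htrans h
    refine ⟨_, isUniversalObstruction_of_cofinal hrefl htrans h hp (fun C k => enumGraph (g C k))
      fun C hC => (hg C hC).2, ?_⟩
    rw [← Set.image_image (fun f k => enumGraph (f k)) g]
    refine isEffective_image_enumGraph (hfin.image g) ?_
    rintro _ ⟨C, hC, rfl⟩
    exact (hg C hC).1
  · intro h
    refine ⟨hwqo, ⟨fun ρ => ?_⟩⟩
    obtain ⟨S, hS, hfin, -⟩ := h (radoParam le ρ) fun H G hHG =>
      iSup₂_le fun x hx => le_iSup₂_of_le x (htrans _ _ _ hx hHG) le_rfl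
    exact radoParam_no_finite_obstruction hrefl htrans ρ hfin hS
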